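/- Let $k$ be an algebraically closed field of characteristic zero and let $L$ be a Lie algebra over $k$ of finite dimension $n$. Put $C^1(L)=L$ and $C^i(L)=[L,C^{i-1}(L)]$ for $i\ge 2$; $L$ is called filiform if $\dim C^i(L)=n-i$ for $i=2,\dots,n$. For $\xi\in L^*$ let $L(\xi)=\{x\in L\mid \xi([x,y])=0 \text{ for all } y\in L\}$, let $i(L)=\min_{\xi\in L^*}\dim L(\xi)$ be the index of $L$, and let $c(L)=\tfrac12(\dim L+i(L))$. Let $\alpha(L)$ be the maximum of the dimensions of the abelian Lie subalgebras of $L$. **Theorem.** If $L$ is filiform and $n\le 11$, then $L$ satisfies the $R$-property: $L$ has an abelian Lie subalgebra of dimension $c(L)$ or an abelian Lie subalgebra of dimension $c(L)-1$. In other words, $\alpha(L)\ge c(L)-1$. -/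

import Mathlib

namespace FiliformR

open Module

section

variable (k : Type*) (L : Type*) [Field k] [LieRing L] [LieAlgebra k L]

/-- The stabilizer `L(ξ) = {x ∈ L | ξ([x, y]) = 0 for all y ∈ L}` of a linear functional `ξ`. -/
def stabilizer {k : Type*} {L : Type*} [Field k] [LieRing L] [LieAlgebra k L]
    (ξ : Dual k L) : Submodule k L where
  carrier := {x | ∀ y : L, ξ ⁅x, y⁆ = 0}
  zero_mem' := fun y => by simp
  add_mem' := fun {a b} ha hb y => by
    rw [add_lie, map_add, ha y, hb y, add_zero]
  smul_mem' := fun c x hx y => by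
    rw [smul_lie, map_smul, hx y, smul_zero]

/-- The index `i(L)`: the minimal value of `dim L(ξ)`, over all linear functionals `ξ`. -/
noncomputable def index : ℕ :=
  sInf {d : ℕ | ∃ ξ : Dual k L, finrank k (stabilizer ξ) = d}

/-- The magic number `c(L) = (dim L + i(L)) / 2`, as a rational number. -/
noncomputable def magicNumber : ℚ :=
  ((finrank k L : ℚ) + (index k L : ℚ)) / 2

/-- The maximal abelian dimension `α(L)`: the maximum dimension of the abelian
Lie subalgebras of `L` (for finite-dimensional `L`). -/
noncomputable def maxAbelianDim : ℕ :=
  sSup {d : ℕ | ∃ H : LieSubalgebra k L, IsLieAbelian H ∧ finrank k H = d}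

/-- `L` admits a commutative polarization: an abelian subalgebra of dimension `c(L)`. -/
def HasCP : Prop :=
  ∃ P : LieSubalgebra k L, IsLieAbelian P ∧ (finrank k P : ℚ) = magicNumber k L

/-- Rentschler's property (the R-property): `L` admits a commutative polarization, or an
abelian subalgebra of dimension `c(L) - 1`. -/
def HasRProperty : Prop :=
  HasCP k L ∨
    ∃ H : LieSubalgebra k L, IsLieAbelian H ∧ (finrank k H : ℚ) = magicNumber k L - 1

/-- The descending central series `C^1(L) = L`, `C^i(L) = [L, C^{i-1}(L)]`. The series of
Mathlib starts at index `0`, so that `C^i(L)` is its term of index `i - 1`. -/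
abbrev centralSeries (i : ℕ) : LieIdeal k L :=
  LieModule.lowerCentralSeries k L L (i - 1)

/-- With `n = dim L`, the Lie algebra `L` is filiform if `dim C^i(L) = n - i` for
`i = 2, …, n`. -/
def IsFiliform : Prop :=
  ∀ i : ℕ, 2 ≤ i → i ≤ finrank k L →
    finrank k (centralSeries k L i) = finrank k L - i

end

end FiliformR

/-! Let `r = n - i(L)`, the generic rank of the forms `ξ([x, y])`; it is even. Since `c(L) = n -
r/2`, it suffices to find an abelian subspace of codimension at most `r/2 + 1`; subspaces of it give
abelian subalgebras of every smaller dimension.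

If `r ≤ 2`, all 4×4 Pfaffians vanish, and perturbing `ξ` yields an abelian subspace of codimension
at most 2 (`exists_abelian_of_pfaffian_eq_zero`). If `r = 4`, the same argument runs inside the
centralizer of an element of the last but one nonzero term of the central series: this centralizer
has codimension at most 1, and rank 4 on it would force rank 6 on `L`.

If `r` is so large that `i(L) ≤ 3`, the middle term of the central series is abelian and big enough.
For `n ≤ 11` this leaves only `r = 6` with `n = 10` or `n = 11`. There `C^4(L)`, of codimension 4,
is abelian: in a basis adapted to the central series, the Jacobi identity restricts the leading
structure constants so much that a nonzero bracket in `C^4(L)` would produce a form of rank at least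
8 (`IsFrame.abelian_or_hasRankOn_of_nine`, `IsFrame.abelian_or_hasRankOn_of_ten`). -/

namespace FiliformR

open Module

/-! ### Ranks of the forms `ξ([x, y])`, the index, and abelian subspaces. -/

section LinearAlgebra

variable {k L : Type*} [Field k] [LieRing L] [LieAlgebra k L]

/-- The form `ξ([x, y])` has a nondegenerate Gram matrix on some family of `m` vectors of `V`. -/
def HasRankOn (ξ : Dual k L) (V : Submodule k L) (m : ℕ) : Prop :=
  ∃ v : Fin m → L, (∀ i, v i ∈ V) ∧
    ∀ x : Fin m → k, (∀ j, ∑ i, x i * ξ ⁅v i, v j⁆ = 0) → x = 0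

theorem hasRankOn_zero (ξ : Dual k L) (V : Submodule k L) : HasRankOn ξ V 0 :=
  ⟨Fin.elim0, fun i => i.elim0, fun _ _ => Subsingleton.elim _ _⟩

theorem HasRankOn.mono {ξ : Dual k L} {V V' : Submodule k L} {m : ℕ}
    (h : HasRankOn ξ V m) (hV : V ≤ V') : HasRankOn ξ V' m :=
  let ⟨v, hv, hx⟩ := h
  ⟨v, fun i => hV (hv i), hx⟩

/-- As `w` is orthogonal to `V` but not to `u`, the enlarged Gram matrix is block triangular up to
reordering, whatever `u` does to `V`. -/
theorem HasRankOn.extend {ξ : Dual k L} {V V' : Submodule k L} {m : ℕ}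
    (h : HasRankOn ξ V m) (hV : V ≤ V') {u w : L} (hu : u ∈ V') (hw : w ∈ V')
    (huw : ξ ⁅u, w⁆ ≠ 0) (hwV : ∀ y ∈ V, ξ ⁅y, w⁆ = 0) : HasRankOn ξ V' (m + 2) := by
  obtain ⟨v, hv, hx⟩ := h
  refine ⟨Fin.cons u (Fin.cons w v), ?_, ?_⟩
  · intro i
    refine Fin.cases hu (fun i => ?_) i
    refine Fin.cases hw (fun i => ?_) i
    exact hV (hv i)
  · intro x H
    have hw' : ∀ y ∈ V, ξ ⁅w, y⁆ = 0 := fun y hy => by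
      rw [← lie_skew, map_neg, hwV y hy, neg_zero]
    have h1 := H 1
    have h1' : (1 : Fin (m + 2)) = Fin.succ 0 := rfl
    simp only [Fin.sum_univ_succ, h1', Fin.cons_succ, Fin.cons_zero, lie_self, map_zero,
      mul_zero, hwV _ (hv _), Finset.sum_const_zero, add_zero] at h1
    have hx0 : x 0 = 0 := (mul_eq_zero.1 h1).resolve_right huw
    have hrest : (fun i : Fin m => x i.succ.succ) = 0 := by
      apply hx
      intro j
      have hj := H j.succ.succ
      simpa [Fin.sum_univ_succ, hx0, hw' _ (hv j)] using hj
    have hx1 : x (Fin.succ 0) = 0 := by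
      have h0 := H 0
      have hz : ∀ i : Fin m, x i.succ.succ = 0 := fun i => congrFun hrest i
      simp only [Fin.sum_univ_succ, Fin.cons_succ, Fin.cons_zero, lie_self, map_zero, hz,
        mul_zero, zero_add, zero_mul, Finset.sum_const_zero, add_zero] at h0
      refine (mul_eq_zero.1 h0).resolve_right ?_
      rw [← lie_skew, map_neg]
      exact neg_ne_zero.2 huw
    funext i
    refine Fin.cases hx0 (fun i => ?_) i
    refine Fin.cases hx1 (fun i => ?_) i
    exact congrFun hrest i

/-- The Pfaffian of the Gram matrix of four vectors. -/
def pfaffian (ξ : Dual k L) (a b c d : L) : k :=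
  ξ ⁅a, b⁆ * ξ ⁅c, d⁆ - ξ ⁅a, c⁆ * ξ ⁅b, d⁆ + ξ ⁅a, d⁆ * ξ ⁅b, c⁆

theorem hasRankOn_of_pfaffian_ne_zero {ξ : Dual k L} {V : Submodule k L} {a b c d : L}
    (ha : a ∈ V) (hb : b ∈ V) (hc : c ∈ V) (hd : d ∈ V) (h : pfaffian ξ a b c d ≠ 0) :
    HasRankOn ξ V 4 := by
  refine ⟨![a, b, c, d], ?_, ?_⟩
  · intro i
    fin_cases i <;> simpa
  · intro x H
    have h0 := H 0
    have h1 := H 1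
    have h2 := H 2
    have h3 := H 3
    have e : ∀ y z : L, ξ ⁅y, z⁆ = - ξ ⁅z, y⁆ := fun y z => by rw [← lie_skew, map_neg]
    simp only [Fin.sum_univ_four, Matrix.cons_val, lie_self, map_zero, mul_zero, zero_add,
      add_zero] at h0 h1 h2 h3
    rw [e b a, e c a, e d a] at h0
    rw [e c b, e d b] at h1
    rw [e d c] at h2
    funext i
    refine (mul_eq_zero.1 (?_ : pfaffian ξ a b c d * x i = 0)).resolve_left h
    unfold pfaffian
    fin_cases i
    · simp only [Fin.zero_eta]
      -- The coefficients form the Pfaffian adjugate: its product with the Gram matrix is the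
      -- Pfaffian times the identity, up to sign.
      linear_combination ξ ⁅c, d⁆ * h1 - ξ ⁅b, d⁆ * h2 + ξ ⁅b, c⁆ * h3
    · simp only [Fin.mk_one]
      linear_combination - ξ ⁅c, d⁆ * h0 + ξ ⁅a, d⁆ * h2 - ξ ⁅a, c⁆ * h3
    · simp only [Fin.reduceFinMk]
      linear_combination ξ ⁅b, d⁆ * h0 - ξ ⁅a, d⁆ * h1 + ξ ⁅a, b⁆ * h3
    · simp only [Fin.reduceFinMk]
      linear_combination - ξ ⁅b, c⁆ * h0 + ξ ⁅a, c⁆ * h1 - ξ ⁅a, b⁆ * h2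

theorem index_le_finrank_stabilizer (ξ : Dual k L) : index k L ≤ finrank k (stabilizer ξ) :=
  Nat.sInf_le ⟨ξ, rfl⟩

theorem exists_finrank_stabilizer_eq_index :
    ∃ ξ : Dual k L, finrank k (stabilizer ξ) = index k L :=
  Nat.sInf_mem (s := {d : ℕ | ∃ ξ : Dual k L, finrank k (stabilizer ξ) = d}) ⟨_, 0, rfl⟩

variable [FiniteDimensional k L]

/-- A family with nondegenerate Gram matrix is independent modulo the stabilizer of `ξ`. -/
theorem HasRankOn.index_add_le {ξ : Dual k L} {V : Submodule k L} {m : ℕ}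
    (h : HasRankOn ξ V m) : index k L + m ≤ finrank k L := by
  obtain ⟨v, -, hx⟩ := h
  have hli : LinearIndependent k (fun i => (stabilizer ξ).mkQ (v i)) := by
    rw [Fintype.linearIndependent_iff]
    intro x H
    have H' : ∑ i, x i • v i ∈ stabilizer ξ := by
      rw [← Submodule.ker_mkQ (stabilizer ξ), LinearMap.mem_ker, map_sum]
      simpa using H
    have := hx x (fun j => by
      have := H' (v j)
      simpa [sum_lie] using this)
    exact fun i => congrFun this i
  have h1 := hli.fintype_card_le_finrank
  have h2 := (stabilizer ξ).finrank_quotient_add_finrank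
  have h3 := index_le_finrank_stabilizer ξ
  simp only [Fintype.card_fin] at h1
  omega

/-- The form of a minimizing `ξ` is nondegenerate on a complement of its stabilizer, and a
skew-symmetric matrix of odd order has determinant zero. -/
theorem even_finrank_add_index [CharZero k] : Even (finrank k L + index k L) := by
  obtain ⟨ξ, hξ⟩ := exists_finrank_stabilizer_eq_index (k := k) (L := L)
  obtain ⟨W, hW⟩ := (stabilizer ξ).exists_isCompl
  have hdim := Submodule.finrank_add_eq_of_isCompl hW
  let b := Module.finBasis k W
  let A : Matrix (Fin (finrank k W)) (Fin (finrank k W)) k := fun i j => ξ ⁅(b i : L), (b j : L)⁆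
  have hA : A.transpose = -A := by
    ext i j
    change ξ ⁅(b j : L), (b i : L)⁆ = -ξ ⁅(b i : L), (b j : L)⁆
    rw [← lie_skew, map_neg]
  have hdet : A.det ≠ 0 := by
    intro h0
    obtain ⟨x, hx0, hx⟩ := Matrix.exists_vecMul_eq_zero_iff.2 h0
    apply hx0
    have hb : ∀ y ∈ W, ξ ⁅((∑ i, x i • b i : W) : L), y⁆ = 0 := by
      intro y hy
      have h1 : ∀ j, ξ ⁅((∑ i, x i • b i : W) : L), (b j : L)⁆ = 0 := by
        intro j
        have := congrFun hx j
        simpa [Matrix.vecMul, dotProduct, A, sum_lie] using this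
      have h2 : y = ((∑ i, b.repr ⟨y, hy⟩ i • b i : W) : L) := by rw [b.sum_repr]
      rw [h2, Submodule.coe_sum W (fun i => b.repr ⟨y, hy⟩ i • b i) _, lie_sum, map_sum]
      exact Finset.sum_eq_zero fun j _ => by
        rw [Submodule.coe_smul, lie_smul, map_smul, h1 j, smul_zero]
    have hmem : ((∑ i, x i • b i : W) : L) ∈ stabilizer ξ := by
      intro y
      obtain ⟨s, hs, w, hw, rfl⟩ : ∃ s ∈ stabilizer ξ, ∃ w ∈ W, s + w = y :=
        Submodule.mem_sup.1 (hW.sup_eq_top ▸ Submodule.mem_top)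
      rw [lie_add, map_add, hb w hw, ← lie_skew, map_neg, hs, neg_zero, zero_add]
    have h0 : ((∑ i, x i • b i : W) : L) = 0 :=
      Submodule.disjoint_def.1 hW.disjoint _ hmem (Subtype.property _)
    have h0' : ∑ i, x i • b i = 0 := Subtype.ext h0
    funext i
    exact Fintype.linearIndependent_iff.1 b.linearIndependent x h0' i
  have heven : Even (finrank k W) := by
    by_contra hodd
    rw [Nat.not_even_iff_odd] at hodd
    have h1 := Matrix.det_transpose A
    rw [hA, Matrix.det_neg, Fintype.card_fin, hodd.neg_one_pow] at h1
    apply hdet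
    have : (2 : k) * A.det = 0 := by linear_combination -h1
    exact (mul_eq_zero.1 this).resolve_left two_ne_zero
  rw [← hdim, hξ]
  obtain ⟨r, hr⟩ := heven
  exact ⟨index k L + r, by omega⟩

/-- If all the forms `ξ([x, y])` with `ξ z ≠ 0` have rank at most two on `V`, then `V` has an
abelian subspace of codimension at most two. -/
theorem exists_abelian_of_pfaffian_eq_zero [CharZero k] (V : Submodule k L) {z : L} (hz : z ≠ 0)
    (hpf : ∀ ξ : Dual k L, ξ z ≠ 0 → ∀ a ∈ V, ∀ b ∈ V, ∀ c ∈ V, ∀ d ∈ V, pfaffian ξ a b c d = 0) :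
    ∃ H : Submodule k L, (∀ x ∈ H, ∀ y ∈ H, ⁅x, y⁆ = 0) ∧ finrank k V ≤ finrank k H + 2 := by
  by_cases hV : ∀ a ∈ V, ∀ b ∈ V, ⁅a, b⁆ = 0
  · exact ⟨V, hV, by omega⟩
  push Not at hV
  obtain ⟨a, ha, b, hb, hab⟩ := hV
  obtain ⟨ξ, hξ⟩ := Module.exists_dual_forall_apply_ne_zero (K := k) ![⁅a, b⁆, z]
    (fun i => by fin_cases i <;> simpa)
  have hξ0 : ξ ⁅a, b⁆ ≠ 0 := hξ 0
  have hξz : ξ z ≠ 0 := hξ 1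
  -- The abelian subspace is the orthogonal in `V` of the hyperbolic pair `a, b`, cut out by two
  -- linear equations.
  let f : V →ₗ[k] k × k :=
    ((ξ ∘ₗ LieAlgebra.ad k L a).prod
      (ξ ∘ₗ LieAlgebra.ad k L b)) ∘ₗ V.subtype
  have hf : ∀ x : V, x ∈ LinearMap.ker f → ξ ⁅a, (x : L)⁆ = 0 ∧ ξ ⁅b, (x : L)⁆ = 0 := by
    intro x hx
    simpa [f] using hx
  refine ⟨(LinearMap.ker f).map V.subtype, ?_, ?_⟩
  · rintro _ ⟨c, hc, rfl⟩ _ ⟨d, hd, rfl⟩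
    obtain ⟨hac, hbc⟩ := hf c hc
    obtain ⟨had, hbd⟩ := hf d hd
    simp only [Submodule.subtype_apply]
    rw [← Module.forall_dual_apply_eq_zero_iff k]
    intro η
    have hcd : ξ ⁅(c : L), (d : L)⁆ = 0 := by
      have := hpf ξ hξz a ha b hb c c.2 d d.2
      rw [pfaffian, hac, had] at this
      simpa [hξ0] using this
    -- The Pfaffian of `ξ + t • η`, divided by `t`. The extra factor makes the equation hold also
    -- where `ξ + t • η` kills `z` and the hypothesis says nothing.
    have key : ∀ t : k, t ≠ 0 → (ξ z + t * η z) *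
        ((ξ ⁅a, b⁆ + t * η ⁅a, b⁆) * η ⁅(c : L), (d : L)⁆ - t * (η ⁅a, (c : L)⁆ * η ⁅b, (d : L)⁆
          - η ⁅a, (d : L)⁆ * η ⁅b, (c : L)⁆)) = 0 := by
      intro t ht
      by_cases h0 : ξ z + t * η z = 0
      · rw [h0, zero_mul]
      · have := hpf (ξ + t • η) (by simpa using h0) a ha b hb c c.2 d d.2
        simp only [pfaffian, LinearMap.add_apply, LinearMap.smul_apply, smul_eq_mul, hac, had,
          hbc, hbd, hcd] at this
        refine mul_eq_zero_of_right _ ((mul_eq_zero.1 (?_ : t * _ = 0)).resolve_left ht)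
        linear_combination this
    -- A polynomial `Q` of degree at most 2 satisfies `Q(0) = 3 Q(1) - 3 Q(2) + Q(3)`.
    have h1 := key 1 one_ne_zero
    have h2 := key 2 two_ne_zero
    have h3 := key 3 three_ne_zero
    have : ξ z * ξ ⁅a, b⁆ * η ⁅(c : L), (d : L)⁆ = 0 := by
      linear_combination 3 * h1 - 3 * h2 + h3
    exact (mul_eq_zero.1 this).resolve_left (mul_ne_zero hξz hξ0)
  · rw [Submodule.finrank_map_subtype_eq]
    have h1 := f.finrank_range_add_finrank_ker
    have h2 := (LinearMap.range f).finrank_le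
    rw [Module.finrank_prod, Module.finrank_self] at h2
    omega

/-- An abelian subspace of dimension at least `c(L) - 1` provides the R-property. -/
theorem hasRProperty_of_abelian [CharZero k] {n : ℕ} (hn : finrank k L = n) (H : Submodule k L)
    (hH : ∀ x ∈ H, ∀ y ∈ H, ⁅x, y⁆ = 0) (hdim : n + index k L ≤ 2 * finrank k H + 2) :
    HasRProperty k L ∧ (maxAbelianDim k L : ℚ) ≥ magicNumber k L - 1 := by
  obtain ⟨c, hc⟩ := even_finrank_add_index (k := k) (L := L)
  have hmagic : magicNumber k L = c := by
    have : (finrank k L : ℚ) + index k L = c + c := by exact_mod_cast hc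
    rw [magicNumber, this]
    ring
  -- For `c = 0` no subalgebra has dimension `c - 1`, and the zero subalgebra is a commutative
  -- polarization.
  obtain rfl | hcpos := Nat.eq_zero_or_pos c
  · refine ⟨Or.inl ⟨⊥, ?_, ?_⟩, ?_⟩
    · refine ⟨fun x y => Subtype.ext ?_⟩
      have hx : (x : L) = 0 := (LieSubalgebra.mem_bot _).1 x.2
      rw [LieSubalgebra.coe_bracket, hx, zero_lie]
      rfl
    · rw [hmagic, Nat.cast_zero, Nat.cast_eq_zero]
      exact finrank_bot k L
    · rw [hmagic]
      have : (0 : ℚ) ≤ maxAbelianDim k L := Nat.cast_nonneg _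
      push_cast
      linarith
  · obtain ⟨v, hv⟩ := exists_linearIndependent_of_le_finrank (R := k) (M := H) (n := c - 1)
      (by omega)
    let S : Submodule k L := (Submodule.span k (Set.range v)).map H.subtype
    have hS : S ≤ H := Submodule.map_subtype_le _ _
    let P : LieSubalgebra k L :=
      { S with
        lie_mem' := fun {x y} hx hy => by
          rw [hH x (hS hx) y (hS hy)]
          exact S.zero_mem }
    have hPab : IsLieAbelian P := ⟨fun x y => Subtype.ext (hH x (hS x.2) y (hS y.2))⟩
    have hPdim : finrank k P = c - 1 := by
      change finrank k S = c - 1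
      rw [Submodule.finrank_map_subtype_eq, finrank_span_eq_card hv, Fintype.card_fin]
    have hcast : ((c - 1 : ℕ) : ℚ) = c - 1 := by
      rw [Nat.cast_sub hcpos, Nat.cast_one]
    refine ⟨Or.inr ⟨P, hPab, by rw [hPdim, hmagic, hcast]⟩, ?_⟩
    have hle : c - 1 ≤ maxAbelianDim k L := by
      refine le_csSup ⟨finrank k L, ?_⟩ ⟨P, hPab, hPdim⟩
      rintro _ ⟨Q, -, rfl⟩
      exact Q.toSubmodule.finrank_le
    rw [hmagic, ← hcast]
    exact_mod_cast hle

end LinearAlgebra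

/-! ### Bases adapted to the lower central series. -/

section Frame

variable {k L : Type*} [Field k] [LieRing L] [LieAlgebra k L]

variable (k L) in
/-- The lower central series as a sequence of subspaces. -/
abbrev lcs (i : ℕ) : Submodule k L := (LieModule.lowerCentralSeries k L L i).toSubmodule

theorem lie_mem_lcs_succ (x : L) {y : L} {j : ℕ} (hy : y ∈ lcs k L j) : ⁅x, y⁆ ∈ lcs k L (j + 1) := by
  change ⁅x, y⁆ ∈ LieModule.lowerCentralSeries k L L (j + 1)
  rw [LieModule.lowerCentralSeries_succ]
  exact LieSubmodule.lie_mem_lie (LieSubmodule.mem_top x) hy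

theorem lcs_succ_le {i : ℕ} {S : Submodule k L} (h : ∀ x : L, ∀ y ∈ lcs k L i, ⁅x, y⁆ ∈ S) :
    lcs k L (i + 1) ≤ S := by
  rw [lcs, LieModule.lowerCentralSeries_succ, LieSubmodule.lieIdeal_oper_eq_linear_span',
    Submodule.span_le]
  rintro _ ⟨x, -, y, hy, rfl⟩
  exact h x y hy

theorem lcs_antitone : Antitone (lcs k L) := fun _ _ h =>
  LieModule.antitone_lowerCentralSeries k L L h

theorem lie_mem_lcs_add {i : ℕ} : ∀ {j : ℕ} {x y : L}, x ∈ lcs k L i → y ∈ lcs k L j →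
    ⁅x, y⁆ ∈ lcs k L (i + j + 1) := by
  induction i with
  | zero =>
    intro j x y _ hy
    rw [Nat.zero_add]
    exact lie_mem_lcs_succ x hy
  | succ i ih =>
    intro j x y hx hy
    let S : Submodule k L := (lcs k L (i + 1 + j + 1)).comap (LieAlgebra.ad k L y)
    have : lcs k L (i + 1) ≤ S := by
      refine lcs_succ_le fun u v hv => ?_
      change ⁅y, ⁅u, v⁆⁆ ∈ lcs k L (i + 1 + j + 1)
      rw [← lie_skew, lie_lie]
      refine neg_mem (sub_mem ?_ ?_)
      · rw [show i + 1 + j + 1 = i + j + 1 + 1 by omega]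
        exact lie_mem_lcs_succ u (ih hv hy)
      · rw [show i + 1 + j + 1 = i + (j + 1) + 1 by omega]
        exact ih hv (lie_mem_lcs_succ u hy)
    have h := this hx
    change ⁅y, x⁆ ∈ lcs k L (i + 1 + j + 1) at h
    rw [← lie_skew]
    exact neg_mem h

theorem exists_sub_smul_mem [FiniteDimensional k L] {S T : Submodule k L} (hST : S ≤ T)
    (hdim : finrank k T ≤ finrank k S + 1) {x : L} (hx : x ∈ T) (hxS : x ∉ S) {y : L}
    (hy : y ∈ T) : ∃ c : k, y - c • x ∈ S := by
  have hlt : S < Submodule.span k {x} ⊔ S :=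
    lt_of_le_of_ne le_sup_right fun h => hxS (h ▸ Submodule.mem_sup_left
      (Submodule.mem_span_singleton_self x))
  have h1 := Submodule.finrank_lt_finrank_of_lt hlt
  have h2 : Submodule.span k {x} ⊔ S = T :=
    Submodule.eq_of_le_of_finrank_le
      (sup_le ((Submodule.span_singleton_le_iff_mem _ _).2 hx) hST) (by omega)
  rw [← h2] at hy
  obtain ⟨u, hu, s, hs, rfl⟩ := Submodule.mem_sup.1 hy
  obtain ⟨c, rfl⟩ := Submodule.mem_span_singleton.1 hu
  exact ⟨c, by simpa using hs⟩

variable (k) in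
/-- The span of the terms of a sequence from index `m` on. -/
def tail (g : ℕ → L) (m : ℕ) : Submodule k L := Submodule.span k (g '' Set.Ici m)

theorem mem_tail (g : ℕ → L) {m i : ℕ} (h : m ≤ i) : g i ∈ tail k g m :=
  Submodule.subset_span ⟨i, h, rfl⟩

theorem tail_antitone (g : ℕ → L) : Antitone (tail k g) := fun _ _ h =>
  Submodule.span_mono (Set.image_mono (Set.Ici_subset_Ici.2 h))

theorem tail_le {g : ℕ → L} {m : ℕ} {S : Submodule k L} (h : ∀ i, m ≤ i → g i ∈ S) :
    tail k g m ≤ S := by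
  refine Submodule.span_le.2 ?_
  rintro _ ⟨i, hi, rfl⟩
  exact h i hi

/-- A sequence `g` obtained by iterating `ad X`, of length `N`, that is adapted to the lower
central series of a Lie algebra of maximal nilpotency class. -/
structure IsFrame (k : Type*) {L : Type*} [Field k] [LieRing L] [LieAlgebra k L]
    (X : L) (g : ℕ → L) (N : ℕ) : Prop where
  lie_X : ∀ i, ⁅X, g i⁆ = g (i + 1)
  eq_zero : ∀ i, N ≤ i → g i = 0
  notMem : ∀ i, i < N → g i ∉ tail k g (i + 1)
  lie_mem : ∀ i j, ⁅g i, g j⁆ ∈ tail k g (i + j + 1)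
  lie_zero_one : ⁅g 0, g 1⁆ ∈ tail k g 3
  lcs_eq : ∀ i, 1 ≤ i → lcs k L i = tail k g i

theorem IsFiliform.finrank_lcs (h : IsFiliform k L) {i : ℕ} (hi : 1 ≤ i)
    (hi' : i + 1 ≤ finrank k L) : finrank k (lcs k L i) = finrank k L - (i + 1) :=
  h (i + 1) (by omega) hi'

theorem IsFiliform.lcs_eq_bot [FiniteDimensional k L] (h : IsFiliform k L) {i : ℕ} (hi : 1 ≤ i)
    (hi' : finrank k L ≤ i + 1) : lcs k L i = ⊥ := by
  rw [← Submodule.finrank_eq_zero]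
  -- In dimension at most 1 the filiform condition is empty, but `L` is abelian.
  obtain h2 | h2 := le_or_gt (finrank k L) 1
  · have h3 : lcs k L i ≤ ⊥ := by
      refine (lcs_antitone hi).trans (lcs_succ_le fun x y _ => ?_)
      obtain h0 | h0 : finrank k L = 0 ∨ finrank k L = 1 := by omega
      · rw [finrank_zero_iff] at h0
        rw [Submodule.mem_bot]
        exact Subsingleton.elim _ _
      · obtain ⟨v, -, hv⟩ := finrank_eq_one_iff'.1 h0
        obtain ⟨a, rfl⟩ := hv x
        obtain ⟨b, rfl⟩ := hv y
        simp
    rw [le_bot_iff.1 h3, finrank_bot]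
  · have h3 := h.finrank_lcs (i := finrank k L - 1) (by omega) (by omega)
    have h4 := Submodule.finrank_mono (lcs_antitone (k := k) (L := L)
      (show finrank k L - 1 ≤ i by omega))
    omega

/-- The bad elements for each `i` form a proper subspace, and finitely many proper subspaces do not
cover a space over an infinite field. -/
theorem IsFiliform.exists_generic [FiniteDimensional k L] [CharZero k] (h : IsFiliform k L) :
    ∃ X : L, ∀ i, 1 ≤ i → i + 3 ≤ finrank k L → ∃ y ∈ lcs k L i, ⁅X, y⁆ ∉ lcs k L (i + 2) := by
  let p : Fin (finrank k L - 3) → Submodule k L := fun i =>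
    { carrier := {x | ∀ y ∈ lcs k L (i + 1), ⁅x, y⁆ ∈ lcs k L (i + 3)}
      zero_mem' := fun y _ => by rw [zero_lie]; exact zero_mem _
      add_mem' := fun {a b} ha hb y hy => by rw [add_lie]; exact add_mem (ha y hy) (hb y hy)
      smul_mem' := fun c x hx y hy => by rw [smul_lie]; exact Submodule.smul_mem _ _ (hx y hy) }
  obtain ⟨X, hX⟩ := Submodule.exists_forall_notMem_of_forall_ne_top p fun i hi => by
    have h1 : lcs k L (i + 1 + 1) ≤ lcs k L (i + 3) := lcs_succ_le fun x y hy =>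
      (hi ▸ Submodule.mem_top : x ∈ p i) y hy
    have h2 := Submodule.finrank_mono h1
    have h3 := i.2
    rw [h.finrank_lcs (by omega) (by omega), h.finrank_lcs (by omega) (by omega)] at h2
    omega
  refine ⟨X, fun i hi hi' => ?_⟩
  have := hX ⟨i - 1, by omega⟩
  by_contra hcon
  push Not at hcon
  refine this fun y hy => ?_
  have e1 : i - 1 + 1 = i := by omega
  have e3 : i - 1 + 3 = i + 2 := by omega
  simp only [e1, e3] at hy ⊢
  exact hcon y hy

theorem IsFiliform.exists_isFrame [FiniteDimensional k L] [CharZero k] (h : IsFiliform k L)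
    (hn : 4 ≤ finrank k L) : ∃ (X : L) (g : ℕ → L), IsFrame k X g (finrank k L - 1) := by
  obtain ⟨X, hX⟩ := h.exists_generic
  set n := finrank k L with hndef
  have hd : ∀ i, 1 ≤ i → i + 1 ≤ n → finrank k (lcs k L i) = n - (i + 1) := fun i h1 h2 =>
    h.finrank_lcs h1 h2
  have hX1 : X ∉ lcs k L 1 := by
    intro hmem
    obtain ⟨y, hy, hxy⟩ := hX 1 le_rfl (by omega)
    exact hxy (lie_mem_lcs_add hmem hy)
  have hT1 : finrank k (Submodule.span k {X} ⊔ lcs k L 1 : Submodule k L) = n - 1 := by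
    have hlt : lcs k L 1 < Submodule.span k {X} ⊔ lcs k L 1 :=
      lt_of_le_of_ne le_sup_right fun e => hX1 (e ▸ Submodule.mem_sup_left
        (Submodule.mem_span_singleton_self X))
    have h1 := Submodule.finrank_lt_finrank_of_lt hlt
    have h2 := Submodule.finrank_add_le_finrank_add_finrank (Submodule.span k {X}) (lcs k L 1)
    have h3 := finrank_span_le_card (R := k) ({X} : Set L)
    have h4 := hd 1 le_rfl (by omega)
    simp only [Set.toFinset_singleton, Finset.card_singleton] at h3
    omega
  obtain ⟨v, hv⟩ : ∃ v, v ∉ Submodule.span k {X} ⊔ lcs k L 1 := by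
    by_contra hcon
    push Not at hcon
    rw [(Submodule.eq_top_iff'.2 hcon), finrank_top] at hT1
    omega
  have hdec : ∀ y : L, ∃ a b : k, y - a • v - b • X ∈ lcs k L 1 := by
    intro y
    obtain ⟨a, ha⟩ := exists_sub_smul_mem (k := k) (T := ⊤) le_top
      (by rw [finrank_top]; omega) Submodule.mem_top hv (y := y) Submodule.mem_top
    obtain ⟨b, hb⟩ := exists_sub_smul_mem (k := k) le_sup_right
      (by rw [hT1, hd 1 le_rfl (by omega)]; omega)
      (Submodule.mem_sup_left (Submodule.mem_span_singleton_self X)) hX1 ha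
    exact ⟨a, b, hb⟩
  -- Modulo `lcs k L 1`, `X` and `v` span `L`, so `[X, v]` generates `lcs k L 1` modulo `lcs k L 2`.
  have hf : ⁅X, v⁆ ∉ lcs k L 2 := by
    intro hf
    have h1 : lcs k L (0 + 1) ≤ lcs k L 2 := by
      refine lcs_succ_le fun x y _ => ?_
      obtain ⟨a, b, hx⟩ := hdec x
      obtain ⟨a', b', hy⟩ := hdec y
      have e : ⁅x, y⁆ = ⁅x - a • v - b • X, y⁆
          + (⁅a • v + b • X, y - a' • v - b' • X⁆ + (b * a' - a * b') • ⁅X, v⁆) := by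
        simp only [sub_lie, lie_sub, add_lie, smul_lie, lie_smul, lie_self, smul_zero]
        rw [← lie_skew v X]
        module
      rw [e]
      refine add_mem ?_ (add_mem (lie_mem_lcs_succ _ hy) (Submodule.smul_mem _ _ hf))
      rw [← lie_skew]
      exact neg_mem (lie_mem_lcs_succ _ hx)
    have h2 := Submodule.finrank_mono h1
    rw [hd _ le_rfl (by omega), hd _ (by omega) (by omega)] at h2
    omega
  have hf1 : ⁅X, v⁆ ∈ lcs k L 1 := 
    lie_mem_lcs_succ (j := 0) X (LieSubmodule.mem_top (R := k) (L := L) v)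
  -- `ad X` maps a generator of `lcs i` modulo `lcs (i + 1)` to a generator of the next quotient
  have hstep : ∀ i, 1 ≤ i → i + 3 ≤ n → ∀ u ∈ lcs k L i, u ∉ lcs k L (i + 1) →
      ⁅X, u⁆ ∉ lcs k L (i + 2) := by
    intro i hi hi' u hu hu' hcon
    obtain ⟨y, hy, hxy⟩ := hX i hi hi'
    obtain ⟨c, hc⟩ := exists_sub_smul_mem (lcs_antitone (Nat.le_succ i))
      (by rw [Nat.succ_eq_add_one, hd i hi (by omega), hd (i + 1) (by omega) (by omega)]; omega)
      hu hu' hy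
    apply hxy
    have e : ⁅X, y⁆ = ⁅X, y - c • u⁆ + c • ⁅X, u⁆ := by
      rw [lie_sub, lie_smul]
      abel
    rw [e]
    exact add_mem (lie_mem_lcs_succ X hc) (Submodule.smul_mem _ _ hcon)
  -- Replacing `v` by `v - l • X` leaves `[X, v]` unchanged and removes the leading term of `[g 0, g
  -- 1]`.
  obtain ⟨l, hl⟩ := exists_sub_smul_mem (k := k) (S := lcs k L 3) (T := lcs k L 2)
    (lcs_antitone (by omega)) (by
      rw [hd 2 (by omega) (by omega), hd 3 (by omega) (by omega)]
      omega)
    (lie_mem_lcs_succ X hf1) (hstep 1 le_rfl (by omega) _ hf1 hf) (lie_mem_lcs_succ v hf1)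
  let g : ℕ → L := fun i => ((LieAlgebra.ad k L X) ^ i) (v - l • X)
  have hg0 : g 0 = v - l • X := rfl
  have hgs : ∀ i, ⁅X, g i⁆ = g (i + 1) := fun i => by
    simp only [g, pow_succ', Module.End.mul_apply, LieAlgebra.ad_apply]
  have hg1 : g 1 = ⁅X, v⁆ := by
    rw [← hgs, hg0, lie_sub, lie_smul, lie_self, smul_zero, sub_zero]
  have hgmem : ∀ i, g i ∈ lcs k L i := by
    intro i
    induction i with
    | zero => exact LieSubmodule.mem_top (R := k) (L := L) (g 0)
    | succ i ih =>
      rw [← hgs]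
      exact lie_mem_lcs_succ X ih
  have hgnot : ∀ i, i + 3 ≤ n → g (i + 1) ∉ lcs k L (i + 2) := by
    intro i
    induction i with
    | zero =>
      intro _
      rw [hg1]
      exact hf
    | succ i ih =>
      intro hi
      rw [← hgs]
      exact hstep (i + 1) (by omega) (by omega) _ (hgmem _) (ih (by omega))
  have hle : ∀ i, tail k g i ≤ lcs k L i := fun i =>
    tail_le fun j hj => lcs_antitone hj (hgmem j)
  -- Descending induction on `i`, with `d` bounding the distance to the vanishing terms.
  have hge : ∀ d i, 1 ≤ i → n ≤ i + 1 + d → lcs k L i ≤ tail k g i := by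
    intro d
    induction d with
    | zero =>
      intro i hi hi'
      rw [h.lcs_eq_bot hi (by omega)]
      exact bot_le
    | succ d ih =>
      intro i hi hi' y hy
      obtain hni | hni := le_or_gt n (i + 1)
      · rw [h.lcs_eq_bot hi (by omega)] at hy
        rw [(Submodule.mem_bot k).1 hy]
        exact zero_mem _
      · obtain ⟨j, rfl⟩ : ∃ j, i = j + 1 := ⟨i - 1, by omega⟩
        obtain ⟨c, hc⟩ := exists_sub_smul_mem (k := k) (S := lcs k L (j + 2))
          (T := lcs k L (j + 1)) (lcs_antitone (by omega)) (by
            rw [hd (j + 1) (by omega) (by omega), hd (j + 2) (by omega) (by omega)]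
            omega)
          (hgmem (j + 1)) (hgnot j (by omega)) hy
        have h1 := tail_antitone g (Nat.le_succ (j + 1)) (ih (j + 2) (by omega) (by omega) hc)
        have h2 := add_mem h1 (Submodule.smul_mem _ c (mem_tail (k := k) g (le_refl (j + 1))))
        rwa [sub_add_cancel] at h2
  have heq : ∀ i, 1 ≤ i → lcs k L i = tail k g i := fun i hi =>
    le_antisymm (hge n i hi (by omega)) (hle i)
  refine ⟨X, g, hgs, ?_, ?_, ?_, ?_, heq⟩
  · intro i hi
    have := hgmem i
    rwa [h.lcs_eq_bot (by omega) (by omega), Submodule.mem_bot] at this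
  · intro i hi
    rw [← heq (i + 1) (by omega)]
    obtain _ | j := i
    · intro hcon
      apply hv
      rw [hg0] at hcon
      have h1 : l • X ∈ Submodule.span k {X} :=
        Submodule.smul_mem _ _ (Submodule.mem_span_singleton_self X)
      have h2 := add_mem (Submodule.mem_sup_left h1) (Submodule.mem_sup_right hcon)
      rwa [add_sub_cancel] at h2
    · exact hgnot j (by omega)
  · intro i j
    rw [← heq _ (by omega)]
    exact lie_mem_lcs_add (hgmem i) (hgmem j)
  · rw [← heq _ (by omega), hg0, hg1, sub_lie, smul_lie]
    exact hl

end Frame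

/-! ### Leading structure constants and the Jacobi identity. -/

section Coefficients

variable {k L : Type*} [Field k] [LieRing L] [LieAlgebra k L]

theorem exists_smul_add_of_mem_tail {g : ℕ → L} {m : ℕ} {x : L} (hx : x ∈ tail k g m) :
    ∃ c : k, x - c • g m ∈ tail k g (m + 1) := by
  have hle : tail k g m ≤ Submodule.span k {g m} ⊔ tail k g (m + 1) := by
    refine tail_le fun i hi => ?_
    obtain rfl | hlt := eq_or_lt_of_le hi
    · exact Submodule.mem_sup_left (Submodule.mem_span_singleton_self _)
    · exact Submodule.mem_sup_right (mem_tail g hlt)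
  obtain ⟨u, hu, s, hs, rfl⟩ := Submodule.mem_sup.1 (hle hx)
  obtain ⟨c, rfl⟩ := Submodule.mem_span_singleton.1 hu
  exact ⟨c, by simpa using hs⟩

theorem lie_mem_tail_of_forall {g : ℕ → L} {y : L} {m p : ℕ}
    (h : ∀ i, m ≤ i → ⁅y, g i⁆ ∈ tail k g p) {x : L} (hx : x ∈ tail k g m) :
    ⁅y, x⁆ ∈ tail k g p :=
  tail_le (S := (tail k g p).comap (LieAlgebra.ad k L y)) h hx

/-- The leading coefficients `b i j` of the brackets of a frame that raise degrees by `s + 1`. -/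
structure IsLeadingCoeff (g : ℕ → L) (N s : ℕ) (b : ℕ → ℕ → k) : Prop where
  antisymm : ∀ i j, b i j = -b j i
  succ : ∀ i j, i + j + 2 + s < N → b i j = b (i + 1) j + b i (j + 1)
  jacobi : ∀ i j l, i + j + l + 2 + 2 * s < N →
    b j l * b i (j + l + 1 + s) = b i j * b (i + j + 1 + s) l + b i l * b j (i + l + 1 + s)
  sub_mem : ∀ i j, i + j + 1 + s < N →
    ⁅g i, g j⁆ - b i j • g (i + j + 1 + s) ∈ tail k g (i + j + 2 + s)

theorem IsFrame.tail_eq_bot {X : L} {g : ℕ → L} {N : ℕ} (h : IsFrame k X g N) {m : ℕ}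
    (hm : N ≤ m) : tail k g m = ⊥ :=
  le_bot_iff.1 (tail_le fun i hi => (Submodule.mem_bot k).2 (h.eq_zero i (hm.trans hi)))

/-- The relations compare leading terms in the Leibniz rule, for `ad X` in `succ` and for `ad (g i)`
in `jacobi`. -/
theorem IsFrame.exists_leadingCoeff {X : L} {g : ℕ → L} {N s : ℕ} (h : IsFrame k X g N)
    (hs : ∀ i j, ⁅g i, g j⁆ ∈ tail k g (i + j + 1 + s)) :
    ∃ b : ℕ → ℕ → k, IsLeadingCoeff g N s b := by
  have hφ : ∀ m, ∃ φ : Dual k L, m < N → φ (g m) = 1 ∧ ∀ x ∈ tail k g (m + 1), φ x = 0 := by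
    intro m
    by_cases hm : m < N
    · obtain ⟨f, hf, hle⟩ := Submodule.exists_le_ker_of_notMem (h.notMem m hm)
      refine ⟨(f (g m))⁻¹ • f, fun _ => ⟨?_, fun x hx => ?_⟩⟩
      · simp [hf]
      · have : f x = 0 := hle hx
        simp [this]
    · exact ⟨0, fun h => absurd h hm⟩
  choose φ hφ using hφ
  have hlead : ∀ {m x}, m < N → x ∈ tail k g m → x - φ m x • g m ∈ tail k g (m + 1) := by
    intro m x hm hx
    obtain ⟨c, hc⟩ := exists_smul_add_of_mem_tail hx
    have h1 := (hφ m hm).2 _ hc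
    rw [map_sub, map_smul, (hφ m hm).1, smul_eq_mul, mul_one, sub_eq_zero] at h1
    rwa [h1]
  -- the leading coefficient of `[y, x]` when `y` raises degrees by `d`
  have hmul : ∀ {y : L} {m d x}, m + d < N → x ∈ tail k g m →
      (∀ i, m + 1 ≤ i → ⁅y, g i⁆ ∈ tail k g (m + d + 1)) →
      φ (m + d) ⁅y, x⁆ = φ m x * φ (m + d) ⁅y, g m⁆ := by
    intro y m d x hm hx hy
    have h1 := (hφ _ hm).2 _ (lie_mem_tail_of_forall hy (hlead (by omega) hx))
    rw [lie_sub, lie_smul, map_sub, map_smul, smul_eq_mul, sub_eq_zero] at h1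
    exact h1
  have hanti : ∀ i j, φ (i + j + 1 + s) ⁅g i, g j⁆ = -φ (j + i + 1 + s) ⁅g j, g i⁆ := by
    intro i j
    rw [← lie_skew, map_neg, Nat.add_comm i j]
  refine ⟨fun i j => φ (i + j + 1 + s) ⁅g i, g j⁆, hanti, ?_, ?_, ?_⟩
  · intro i j hij
    have h1 := hmul (y := X) (m := i + j + 1 + s) (d := 1) (by omega) (hs i j) fun l hl => by
      rw [h.lie_X]
      exact mem_tail g (by omega)
    rw [h.lie_X, (hφ _ (by omega)).1, mul_one, leibniz_lie, h.lie_X, h.lie_X, map_add] at h1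
    rw [show i + 1 + j + 1 + s = i + j + 1 + s + 1 by omega,
      show i + (j + 1) + 1 + s = i + j + 1 + s + 1 by omega]
    exact h1.symm
  · intro i j l hijl
    have key : ∀ i j l, i + j + l + 2 + 2 * s < N → φ (i + j + l + 2 + 2 * s) ⁅g i, ⁅g j, g l⁆⁆ =
        φ (j + l + 1 + s) ⁅g j, g l⁆ * φ (i + (j + l + 1 + s) + 1 + s)
          ⁅g i, g (j + l + 1 + s)⁆ := by
      intro i j l hijl
      have h1 := hmul (y := g i) (m := j + l + 1 + s) (d := i + 1 + s) (by omega) (hs j l)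
        fun q hq => tail_antitone g (by omega) (hs i q)
      rw [show j + l + 1 + s + (i + 1 + s) = i + (j + l + 1 + s) + 1 + s by omega] at h1
      rw [show i + j + l + 2 + 2 * s = i + (j + l + 1 + s) + 1 + s by omega]
      exact h1
    have e1 := key i j l hijl
    have e2 := key l i j (by omega)
    have e3 := key j i l (by omega)
    rw [show l + i + j + 2 + 2 * s = i + j + l + 2 + 2 * s by omega] at e2
    rw [show j + i + l + 2 + 2 * s = i + j + l + 2 + 2 * s by omega] at e3
    have e4 := hanti l (i + j + 1 + s)
    have e5 := congrArg (φ (i + j + l + 2 + 2 * s)) (leibniz_lie (g i) (g j) (g l))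
    rw [← lie_skew ⁅g i, g j⁆ (g l), map_add, map_neg, e1, e2, e3, e4] at e5
    rw [e5]
    ring
  · intro i j hij
    rw [show i + j + 2 + s = i + j + 1 + s + 1 by omega]
    exact hlead hij (hs i j)

namespace IsLeadingCoeff

variable {g : ℕ → L} {N s : ℕ} {b : ℕ → ℕ → k}

theorem self_eq_zero [CharZero k] (hb : IsLeadingCoeff g N s b) (i : ℕ) : b i i = 0 := by
  have h := hb.antisymm i i
  have h2 : (2 : k) * b i i = 0 := by linear_combination h
  exact (mul_eq_zero.1 h2).resolve_left two_ne_zero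

theorem zero_one_eq_zero {X : L} (h : IsFrame k X g N) (hb : IsLeadingCoeff g N 0 b)
    (hN : 2 < N) : b 0 1 = 0 := by
  by_contra hne
  apply h.notMem 2 hN
  have h1 := _root_.sub_mem h.lie_zero_one (hb.sub_mem 0 1 hN)
  rw [sub_sub_cancel] at h1
  exact (Submodule.smul_mem_iff _ hne).1 h1

/-- By induction on `j - i`: the relation `succ` expresses `b i (j + 1)` through coefficients closer
to the diagonal. -/
theorem eq_zero_of_consecutive [CharZero k] (hb : IsLeadingCoeff g N s b)
    (h : ∀ i, 2 * i + 2 + s < N → b i (i + 1) = 0) (i j : ℕ) (hij : i + j + 1 + s < N) :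
    b i j = 0 := by
  have key : ∀ d i, 2 * i + d + 1 + s < N → b i (i + d) = 0 ∧
      (2 * i + d + 2 + s < N → b i (i + d + 1) = 0) := by
    intro d
    induction d with
    | zero => exact fun i _ => ⟨hb.self_eq_zero i, h i⟩
    | succ d ih =>
      intro i hi
      refine ⟨(ih i (by omega)).2 (by omega), fun hi' => ?_⟩
      have h1 := hb.succ i (i + d + 1) (by omega)
      have h2 := (ih i (by omega)).2 (by omega)
      have h3 := (ih (i + 1) (by omega)).1
      rw [show i + 1 + d = i + d + 1 by omega] at h3
      rw [h2, h3, zero_add] at h1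
      exact h1.symm
  obtain hle | hle := le_total i j
  · obtain ⟨d, rfl⟩ := Nat.exists_eq_add_of_le hle
    exact (key d i (by omega)).1
  · obtain ⟨d, rfl⟩ := Nat.exists_eq_add_of_le hle
    rw [hb.antisymm, (key d j (by omega)).1, neg_zero]

/-- The recursion makes `b 0 4` a multiple of `b 1 2`, and the Jacobi identity for `0, 1, 2` then
says that a nonzero multiple of `b 1 2 ^ 2` vanishes. The triples `0, 2, 3` and `0, 3, 4` do the
same for the next two consecutive coefficients. -/
theorem one_two_eq_zero [CharZero k] (hb : IsLeadingCoeff g N 0 b) (h01 : b 0 1 = 0)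
    (hN : 5 < N) : b 1 2 = 0 := by
  have r01 := hb.succ 0 1 (by omega)
  have r02 := hb.succ 0 2 (by omega)
  have r12 := hb.succ 1 2 (by omega)
  have r03 := hb.succ 0 3 (by omega)
  have d1 := hb.self_eq_zero 1
  have d2 := hb.self_eq_zero 2
  have J := hb.jacobi 0 1 2 (by omega)
  norm_num at r01 r02 r12 r03 J
  have e02 : b 0 2 = 0 := by linear_combination h01 - r01 - d1
  have e04 : b 0 4 = -2 * b 1 2 := by linear_combination e02 - r03 - r02 + r12 + d2
  rw [h01, e02, e04] at J
  have : (2 : k) * b 1 2 ^ 2 = 0 := by linear_combination -J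
  simpa using this

theorem two_three_eq_zero [CharZero k] (hb : IsLeadingCoeff g N 0 b) (h01 : b 0 1 = 0)
    (hN : 7 < N) : b 2 3 = 0 := by
  have h12 := hb.one_two_eq_zero h01 (by omega)
  have r01 := hb.succ 0 1 (by omega)
  have r02 := hb.succ 0 2 (by omega)
  have r12 := hb.succ 1 2 (by omega)
  have r03 := hb.succ 0 3 (by omega)
  have r13 := hb.succ 1 3 (by omega)
  have r04 := hb.succ 0 4 (by omega)
  have r23 := hb.succ 2 3 (by omega)
  have r14 := hb.succ 1 4 (by omega)
  have r05 := hb.succ 0 5 (by omega)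
  have d1 := hb.self_eq_zero 1
  have d2 := hb.self_eq_zero 2
  have d3 := hb.self_eq_zero 3
  have J := hb.jacobi 0 2 3 (by omega)
  norm_num at r01 r02 r12 r03 r13 r04 r23 r14 r05 J
  have e02 : b 0 2 = 0 := by linear_combination h01 - r01 - d1
  have e03 : b 0 3 = 0 := by linear_combination e02 - r02 - h12
  have e13 : b 1 3 = 0 := by linear_combination h12 - r12 - d2
  have e04 : b 0 4 = 0 := by linear_combination e03 - r03 - e13
  have e14 : b 1 4 = -b 2 3 := by linear_combination e13 - r13
  have e05 : b 0 5 = b 2 3 := by linear_combination e04 - r04 - e14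
  have e24 : b 2 4 = b 2 3 := by linear_combination -r23 - d3
  have e15 : b 1 5 = -2 * b 2 3 := by linear_combination e14 - r14 - e24
  have e06 : b 0 6 = 3 * b 2 3 := by linear_combination e05 - r05 - e15
  rw [e02, e03, e06] at J
  have : (3 : k) * b 2 3 ^ 2 = 0 := by linear_combination J
  simpa using this

/-- In degree seven the leading coefficients alternate. -/
theorem antidiagonal_seven [CharZero k] (hb : IsLeadingCoeff g N 0 b) (h01 : b 0 1 = 0)
    (hN : 8 < N) : b 2 5 = -b 3 4 ∧ b 1 6 = b 3 4 ∧ b 0 7 = -b 3 4 := by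
  have h12 := hb.one_two_eq_zero h01 (by omega)
  have h23 := hb.two_three_eq_zero h01 (by omega)
  have d1 := hb.self_eq_zero 1
  have d2 := hb.self_eq_zero 2
  have d3 := hb.self_eq_zero 3
  have r01 := hb.succ 0 1 (by omega)
  have r02 := hb.succ 0 2 (by omega)
  have r12 := hb.succ 1 2 (by omega)
  have r03 := hb.succ 0 3 (by omega)
  have r13 := hb.succ 1 3 (by omega)
  have r04 := hb.succ 0 4 (by omega)
  have r23 := hb.succ 2 3 (by omega)
  have r14 := hb.succ 1 4 (by omega)
  have r05 := hb.succ 0 5 (by omega)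
  have r24 := hb.succ 2 4 (by omega)
  have r15 := hb.succ 1 5 (by omega)
  have r06 := hb.succ 0 6 (by omega)
  norm_num at r01 r02 r12 r03 r13 r04 r23 r14 r05 r24 r15 r06
  have e13 : b 1 3 = 0 := by linear_combination h12 - r12 - d2
  have e14 : b 1 4 = 0 := by linear_combination e13 - r13 - h23
  have e24 : b 2 4 = 0 := by linear_combination -r23 - d3 + h23
  have e15 : b 1 5 = 0 := by linear_combination e14 - r14 - e24
  have e02 : b 0 2 = 0 := by linear_combination h01 - r01 - d1
  have e03 : b 0 3 = 0 := by linear_combination e02 - r02 - h12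
  have e04 : b 0 4 = 0 := by linear_combination e03 - r03 - e13
  have e05 : b 0 5 = 0 := by linear_combination e04 - r04 - e14
  have e06 : b 0 6 = 0 := by linear_combination e05 - r05 - e15
  have e25 : b 2 5 = -b 3 4 := by linear_combination e24 - r24
  have e16 : b 1 6 = b 3 4 := by linear_combination e15 - r15 - e25
  exact ⟨e25, e16, by linear_combination e06 - r06 - e16⟩

theorem three_four_eq_zero [CharZero k] (hb : IsLeadingCoeff g N 0 b) (h01 : b 0 1 = 0)
    (hN : 9 < N) : b 3 4 = 0 := by
  have h12 := hb.one_two_eq_zero h01 (by omega)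
  obtain ⟨e25, e16, e07⟩ := hb.antidiagonal_seven h01 (by omega)
  have r01 := hb.succ 0 1 (by omega)
  have r02 := hb.succ 0 2 (by omega)
  have r12 := hb.succ 1 2 (by omega)
  have r03 := hb.succ 0 3 (by omega)
  have r34 := hb.succ 3 4 (by omega)
  have r25 := hb.succ 2 5 (by omega)
  have r16 := hb.succ 1 6 (by omega)
  have r07 := hb.succ 0 7 (by omega)
  have d1 := hb.self_eq_zero 1
  have d2 := hb.self_eq_zero 2
  have d4 := hb.self_eq_zero 4
  have J := hb.jacobi 0 3 4 (by omega)
  norm_num at r01 r02 r12 r03 r34 r25 r16 r07 J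
  have e02 : b 0 2 = 0 := by linear_combination h01 - r01 - d1
  have e03 : b 0 3 = 0 := by linear_combination e02 - r02 - h12
  have e13 : b 1 3 = 0 := by linear_combination h12 - r12 - d2
  have e04 : b 0 4 = 0 := by linear_combination e03 - r03 - e13
  have e35 : b 3 5 = b 3 4 := by linear_combination -r34 - d4
  have e26 : b 2 6 = -2 * b 3 4 := by linear_combination e25 - r25 - e35
  have e17 : b 1 7 = 3 * b 3 4 := by linear_combination e16 - r16 - e26
  have e08 : b 0 8 = -4 * b 3 4 := by linear_combination e07 - r07 - e17
  rw [e03, e04, e08] at J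
  have : (4 : k) * b 3 4 ^ 2 = 0 := by linear_combination -J
  simpa using this

/-- For brackets that raise degrees by two, at most one leading coefficient in degree seven
vanishes unless `b 3 4` does. -/
theorem antidiagonal_seven_of_shift_one [CharZero k] (hb : IsLeadingCoeff g N 1 b) (hN : 9 < N)
    (h34 : b 3 4 ≠ 0) : (b 2 5 ≠ 0 ∨ b 1 6 ≠ 0) ∧ (b 2 5 ≠ 0 ∨ b 0 7 ≠ 0) ∧
      (b 1 6 ≠ 0 ∨ b 0 7 ≠ 0) := by
  have d1 := hb.self_eq_zero 1
  have d2 := hb.self_eq_zero 2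
  have d3 := hb.self_eq_zero 3
  have r01 := hb.succ 0 1 (by omega)
  have r02 := hb.succ 0 2 (by omega)
  have r12 := hb.succ 1 2 (by omega)
  have r03 := hb.succ 0 3 (by omega)
  have r13 := hb.succ 1 3 (by omega)
  have r04 := hb.succ 0 4 (by omega)
  have r23 := hb.succ 2 3 (by omega)
  have r14 := hb.succ 1 4 (by omega)
  have r05 := hb.succ 0 5 (by omega)
  have r24 := hb.succ 2 4 (by omega)
  have r15 := hb.succ 1 5 (by omega)
  have r06 := hb.succ 0 6 (by omega)
  have J012 := hb.jacobi 0 1 2 (by omega)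
  have J014 := hb.jacobi 0 1 4 (by omega)
  have J023 := hb.jacobi 0 2 3 (by omega)
  have a32 := hb.antisymm 3 2
  have a43 := hb.antisymm 4 3
  norm_num at r01 r02 r12 r03 r13 r04 r23 r14 r05 r24 r15 r06 J012 J014 J023
  have e02 : b 0 2 = b 0 1 := by linear_combination -r01 - d1
  have e13 : b 1 3 = b 1 2 := by linear_combination -r12 - d2
  have e24 : b 2 4 = b 2 3 := by linear_combination -r23 - d3
  have e03 : b 0 3 = b 0 1 - b 1 2 := by linear_combination e02 - r02
  have e14 : b 1 4 = b 1 2 - b 2 3 := by linear_combination e13 - r13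
  have e25 : b 2 5 = b 2 3 - b 3 4 := by linear_combination e24 - r24
  have e04 : b 0 4 = b 0 1 - 2 * b 1 2 := by linear_combination e03 - r03 - e13
  have e15 : b 1 5 = b 1 2 - 2 * b 2 3 := by linear_combination e14 - r14 - e24
  have e05 : b 0 5 = b 0 1 - 3 * b 1 2 + b 2 3 := by linear_combination e04 - r04 - e14
  have e06 : b 0 6 = b 0 1 - 4 * b 1 2 + 3 * b 2 3 := by linear_combination e05 - r05 - e15
  have e16 : b 1 6 = b 1 2 - 3 * b 2 3 + b 3 4 := by linear_combination e15 - r15 - e25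
  have e07 : b 0 7 = b 0 1 - 5 * b 1 2 + 6 * b 2 3 - b 3 4 := by
    linear_combination e06 - r06 - e16
  rw [e02, e05, e14, a32] at J012
  rw [e14, e04] at J014
  rw [e02, e03, a43] at J023
  -- Everything is expressed through `b 0 1`, `b 1 2`, `b 2 3`, `b 3 4`. Two vanishing coefficients
  -- and one Jacobi identity make all four proportional to `b 3 4`; a further identity then gives `b
  -- 3 4 = 0`.
  refine ⟨?_, ?_, ?_⟩ <;> by_contra hcon <;> push Not at hcon <;> obtain ⟨hx, hy⟩ := hcon
  · have h23 : b 2 3 = b 3 4 := by linear_combination hx - e25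
    have h12 : b 1 2 = 2 * b 3 4 := by linear_combination hy - e16 + 3 * h23
    rw [h23, h12] at J012
    have h01 : b 0 1 = 5 * b 3 4 := by
      have : 2 * b 3 4 * (b 0 1 - 5 * b 3 4) = 0 := by linear_combination J012
      have := (mul_eq_zero.1 this).resolve_left (mul_ne_zero two_ne_zero h34)
      linear_combination this
    rw [hx, e07, h01, h12, h23] at J023
    have : (5 : k) * b 3 4 ^ 2 = 0 := by linear_combination J023
    exact h34 (by simpa using this)
  · have h23 : b 2 3 = b 3 4 := by linear_combination hx - e25
    rw [hx, hy] at J023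
    have h01 : b 0 1 = 0 := by
      have : b 0 1 * b 3 4 = 0 := by linear_combination J023
      exact (mul_eq_zero.1 this).resolve_right h34
    have h12 : b 1 2 = b 3 4 := by
      have : (5 : k) * (b 1 2 - b 3 4) = 0 := by linear_combination -hy + e07 + h01 + 6 * h23
      have := (mul_eq_zero.1 this).resolve_left (by norm_num)
      linear_combination this
    rw [h01, h12, h23] at J012
    have : (2 : k) * b 3 4 ^ 2 = 0 := by linear_combination -J012
    exact h34 (by simpa using this)
  · rw [hx, hy] at J014
    have h01 : b 0 1 = 0 := by
      have : b 0 1 * b 3 4 = 0 := by linear_combination -J014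
      exact (mul_eq_zero.1 this).resolve_right h34
    have h12 : b 1 2 = 3 * b 2 3 - b 3 4 := by linear_combination hx - e16
    have h4 : 4 * b 3 4 = 9 * b 2 3 := by linear_combination hy - e07 - h01 + 5 * h12
    rw [h01, h12] at J012
    -- Since `b 2 3 = (4/9) b 3 4`, `J012` reads `-(5/27) b 3 4 ^ 2 = 0`; the second summand carries
    -- out this substitution.
    have : (5 : k) * b 3 4 ^ 2 = 0 := by
      linear_combination -27 * J012 + (13 * b 3 4 - 8 * (4 * b 3 4 - 9 * b 2 3)) * h4
    exact h34 (by simpa using this)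

end IsLeadingCoeff

end Coefficients

/-! ### Abelian subspaces according to the rank. -/

section Abelian

variable {k L : Type*} [Field k] [LieRing L] [LieAlgebra k L]

theorem lie_eq_zero_of_mem_tail {g : ℕ → L} {m p : ℕ}
    (h : ∀ i j, m ≤ i → p ≤ j → ⁅g i, g j⁆ = 0) {x y : L} (hx : x ∈ tail k g m)
    (hy : y ∈ tail k g p) : ⁅x, y⁆ = 0 := by
  have h1 : ∀ i, m ≤ i → ⁅g i, y⁆ = 0 := fun i hi =>
    tail_le (S := LinearMap.ker (LieAlgebra.ad k L (g i))) (fun j hj => h i j hi hj) hy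
  have h2 := tail_le (S := LinearMap.ker (LieAlgebra.ad k L y)) (fun i hi => by
    rw [LinearMap.mem_ker, LieAlgebra.ad_apply, ← lie_skew, h1 i hi, neg_zero]) hx
  rw [LinearMap.mem_ker, LieAlgebra.ad_apply] at h2
  rw [← lie_skew, h2, neg_zero]

theorem lie_eq_zero_of_le {X : L} {g : ℕ → L} {N s : ℕ} (h : IsFrame k X g N)
    (hs : ∀ i j, ⁅g i, g j⁆ ∈ tail k g (i + j + 1 + s)) {i j : ℕ} (hij : N ≤ i + j + 1 + s) :
    ⁅g i, g j⁆ = 0 := by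
  have h1 := hs i j
  rwa [h.tail_eq_bot hij, Submodule.mem_bot] at h1

/-- For degree reasons only `[g 3, g 4]` could survive, and it is `b 3 4` times the last frame
vector. -/
theorem tail_three_abelian [CharZero k] {X : L} {g : ℕ → L} {s : ℕ} {b : ℕ → ℕ → k}
    (h : IsFrame k X g (9 + s)) (hs : ∀ i j, ⁅g i, g j⁆ ∈ tail k g (i + j + 1 + s))
    (hb : IsLeadingCoeff g (9 + s) s b) (h34 : b 3 4 = 0) :
    ∀ x ∈ tail k g 3, ∀ y ∈ tail k g 3, ⁅x, y⁆ = 0 := by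
  have h1 : ⁅g 3, g 4⁆ = 0 := by
    have := hb.sub_mem 3 4 (by omega)
    rwa [h34, zero_smul, sub_zero, h.tail_eq_bot (by omega), Submodule.mem_bot] at this
  refine fun x hx y hy => lie_eq_zero_of_mem_tail (fun i j hi hj => ?_) hx hy
  by_cases h8 : 8 ≤ i + j
  · exact lie_eq_zero_of_le h hs (by omega)
  · obtain ⟨rfl, rfl⟩ | ⟨rfl, rfl⟩ | ⟨rfl, rfl⟩ :
        (i = 3 ∧ j = 3) ∨ (i = 3 ∧ j = 4) ∨ (i = 4 ∧ j = 3) := by omega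
    · exact lie_self _
    · exact h1
    · rw [← lie_skew, h1, neg_zero]

/-- The bracket of `g i` and `g j` falls on the last frame vector, so `g j` commutes with everything
beyond `g i`. -/
theorem HasRankOn.extend_tail {X : L} {g : ℕ → L} {N s m i j : ℕ} {b : ℕ → ℕ → k} {ξ : Dual k L}
    (h : IsFrame k X g N) (hs : ∀ i j, ⁅g i, g j⁆ ∈ tail k g (i + j + 1 + s))
    (hb : IsLeadingCoeff g N s b) (hξ : ξ (g (N - 1)) ≠ 0) (hij : i + j + 2 + s = N)
    (hle : i ≤ j) (hne : b i j ≠ 0) (hr : HasRankOn ξ (tail k g (i + 1)) m) :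
    HasRankOn ξ (tail k g i) (m + 2) := by
  refine hr.extend (tail_antitone g (Nat.le_succ i)) (mem_tail g le_rfl) (mem_tail g hle) ?_ ?_
  · have h1 := hb.sub_mem i j (by omega)
    rw [h.tail_eq_bot (by omega), Submodule.mem_bot, sub_eq_zero] at h1
    rw [h1, map_smul, show i + j + 1 + s = N - 1 by omega]
    exact mul_ne_zero hne hξ
  · intro y hy
    rw [lie_eq_zero_of_mem_tail (p := j) (fun p q hp hq => lie_eq_zero_of_le h hs (by omega)) hy
      (mem_tail g le_rfl), map_zero]

theorem IsFrame.exists_dual {X : L} {g : ℕ → L} {N : ℕ} (h : IsFrame k X g N) (hN : 0 < N) :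
    ∃ ξ : Dual k L, ξ (g (N - 1)) ≠ 0 := by
  obtain ⟨ξ, hξ, -⟩ := Submodule.exists_le_ker_of_notMem (h.notMem (N - 1) (by omega))
  exact ⟨ξ, hξ⟩

/-- If `b 3 4 ≠ 0`, the whole antidiagonal `i + j = 7` is nonzero and its four pairs give rank 8. -/
theorem IsFrame.abelian_or_hasRankOn_of_nine [CharZero k] {X : L} {g : ℕ → L}
    (h : IsFrame k X g 9) : (∀ x ∈ tail k g 3, ∀ y ∈ tail k g 3, ⁅x, y⁆ = 0) ∨
      ∃ (ξ : Dual k L) (V : Submodule k L), HasRankOn ξ V 8 := by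
  obtain ⟨b, hb⟩ := h.exists_leadingCoeff (s := 0) h.lie_mem
  by_cases h34 : b 3 4 = 0
  · exact Or.inl (tail_three_abelian (s := 0) h h.lie_mem hb h34)
  obtain ⟨e25, e16, e07⟩ :=
    hb.antidiagonal_seven (IsLeadingCoeff.zero_one_eq_zero h hb (by omega)) (by omega)
  obtain ⟨ξ, hξ⟩ := h.exists_dual (by omega)
  have ext := fun {m i j} => HasRankOn.extend_tail (s := 0) (m := m) (i := i) (j := j)
    h h.lie_mem hb hξ
  have r3 := ext (i := 3) (j := 4) rfl (by omega) h34 (hasRankOn_zero ξ _)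
  have r2 := ext (i := 2) (j := 5) rfl (by omega) (by rw [e25]; exact neg_ne_zero.2 h34) r3
  have r1 := ext (i := 1) (j := 6) rfl (by omega) (by rwa [e16]) r2
  have r0 := ext (i := 0) (j := 7) rfl (by omega) (by rw [e07]; exact neg_ne_zero.2 h34) r1
  exact Or.inr ⟨ξ, _, r0⟩

/-- The extra dimension leaves room for the Jacobi identity that kills `b 3 4`, so brackets raise
degrees by one more. For the new coefficients, if `b 3 4 ≠ 0` then at least three pairs of the
antidiagonal survive, and `X, g 8` is the fourth. -/
theorem IsFrame.abelian_or_hasRankOn_of_ten [CharZero k] {X : L} {g : ℕ → L}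
    (h : IsFrame k X g 10) : (∀ x ∈ tail k g 3, ∀ y ∈ tail k g 3, ⁅x, y⁆ = 0) ∨
      ∃ (ξ : Dual k L) (V : Submodule k L), HasRankOn ξ V 8 := by
  have hs : ∀ i j, ⁅g i, g j⁆ ∈ tail k g (i + j + 1 + 1) := by
    obtain ⟨b, hb⟩ := h.exists_leadingCoeff (s := 0) h.lie_mem
    have h01 := IsLeadingCoeff.zero_one_eq_zero h hb (by omega)
    have hzero := hb.eq_zero_of_consecutive (fun i hi => by
      obtain rfl | rfl | rfl | rfl : i = 0 ∨ i = 1 ∨ i = 2 ∨ i = 3 := by omega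
      · exact h01
      · exact hb.one_two_eq_zero h01 (by omega)
      · exact hb.two_three_eq_zero h01 (by omega)
      · exact hb.three_four_eq_zero h01 (by omega))
    intro i j
    by_cases hij : i + j + 1 + 0 < 10
    · have h1 := hb.sub_mem i j hij
      rwa [hzero i j hij, zero_smul, sub_zero] at h1
    · rw [lie_eq_zero_of_le (s := 0) h h.lie_mem (by omega)]
      exact zero_mem _
  obtain ⟨b, hb⟩ := h.exists_leadingCoeff hs
  by_cases h34 : b 3 4 = 0
  · exact Or.inl (tail_three_abelian (s := 1) h hs hb h34)
  obtain ⟨c1, c2, c3⟩ := hb.antidiagonal_seven_of_shift_one (by omega) h34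
  obtain ⟨ξ, hξ⟩ := h.exists_dual (by omega)
  have ext := fun {m i j} => HasRankOn.extend_tail (m := m) (i := i) (j := j) h hs hb hξ
  have r3 := ext (i := 3) (j := 4) rfl (by omega) h34 (hasRankOn_zero ξ _)
  have mono := fun {m} (i : ℕ) (hr : HasRankOn ξ (tail k g (i + 1)) m) =>
    hr.mono (tail_antitone g (Nat.le_succ i))
  have r0 : HasRankOn ξ (tail k g 0) 6 := by
    by_cases h25 : b 2 5 = 0
    · have h16 := c1.resolve_left (not_not.2 h25)
      have h07 := c2.resolve_left (not_not.2 h25)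
      exact ext (j := 7) rfl (by omega) h07 (ext (j := 6) rfl (by omega) h16 (mono 2 r3))
    have r2 := ext (i := 2) (j := 5) rfl (by omega) h25 r3
    by_cases h16 : b 1 6 = 0
    · exact ext (j := 7) rfl (by omega) (c3.resolve_left (not_not.2 h16)) (mono 1 r2)
    · exact mono 0 (ext (j := 6) rfl (by omega) h16 r2)
  refine Or.inr ⟨ξ, ⊤, r0.extend (u := X) (w := g 8) le_top Submodule.mem_top Submodule.mem_top
    (by rwa [h.lie_X]) fun y hy => ?_⟩
  rw [lie_eq_zero_of_mem_tail (p := 8) (fun p q hp hq => lie_eq_zero_of_le h hs (by omega)) hy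
    (mem_tail g le_rfl), map_zero]

variable [FiniteDimensional k L]

theorem exists_abelian_of_finrank_lt_index_add_four [CharZero k]
    (hi : finrank k L < index k L + 4) : ∃ H : Submodule k L, (∀ x ∈ H, ∀ y ∈ H, ⁅x, y⁆ = 0) ∧
      finrank k L + index k L ≤ 2 * finrank k H + 2 := by
  by_cases hab : ∀ x y : L, ⁅x, y⁆ = 0
  · refine ⟨⊤, fun x _ y _ => hab x y, ?_⟩
    have := (hasRankOn_zero (0 : Dual k L) ⊤).index_add_le
    rw [finrank_top]
    omega
  push Not at hab
  obtain ⟨u, w, huw⟩ := hab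
  obtain ⟨H, hH, hdim⟩ := exists_abelian_of_pfaffian_eq_zero (k := k) ⊤ huw
    fun ξ _ a _ b _ c _ d _ => by
      by_contra hne
      have := (hasRankOn_of_pfaffian_ne_zero (V := ⊤) Submodule.mem_top Submodule.mem_top
        Submodule.mem_top Submodule.mem_top hne).index_add_le
      omega
  rw [finrank_top] at hdim
  -- A nonzero bracket forces rank at least 2, which is what makes codimension 2 sufficient.
  obtain ⟨ξ, hξ⟩ := (Module.exists_dual_forall_apply_ne_zero (K := k) (fun _ : Unit => ⁅u, w⁆)
    fun _ => huw)
  have h2 := ((hasRankOn_zero ξ ⊥).extend (V' := ⊤) bot_le Submodule.mem_top Submodule.mem_top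
    (hξ ()) fun y hy => by rw [(Submodule.mem_bot k).1 hy, zero_lie, map_zero]).index_add_le
  exact ⟨H, hH, by omega⟩

theorem IsFiliform.exists_abelian_of_finrank_lt_index_add_six [CharZero k] (h : IsFiliform k L)
    (hn : 4 ≤ finrank k L) (hi : finrank k L < index k L + 6) :
    ∃ H : Submodule k L, (∀ x ∈ H, ∀ y ∈ H, ⁅x, y⁆ = 0) ∧ finrank k L ≤ finrank k H + 3 := by
  obtain ⟨X, g, hg⟩ := h.exists_isFrame hn
  obtain ⟨d, hd⟩ : ∃ d, finrank k L = d + 3 := ⟨finrank k L - 3, by omega⟩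
  have hz : g (d + 1) ≠ 0 := fun h0 => hg.notMem (d + 1) (by omega) (h0 ▸ zero_mem _)
  -- With `d = n - 3` the target is a line, so the centralizer of `g d` has codimension at most 1. A
  -- rank 4 family in it, together with `X` and `g d`, would have rank 6.
  have hrange : LinearMap.range (LieAlgebra.ad k L (g d) : L →ₗ[k] L) ≤ lcs k L (d + 1) := by
    rintro _ ⟨y, rfl⟩
    rw [LieAlgebra.ad_apply, ← lie_skew]
    refine neg_mem (lie_mem_lcs_succ y ?_)
    rw [hg.lcs_eq d (by omega)]
    exact mem_tail g le_rfl
  have h1 := Submodule.finrank_mono hrange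
  rw [h.finrank_lcs (by omega) (by omega)] at h1
  have h2 := (LieAlgebra.ad k L (g d) : L →ₗ[k] L).finrank_range_add_finrank_ker
  obtain ⟨H, hH, hdim⟩ := exists_abelian_of_pfaffian_eq_zero
    (LinearMap.ker (LieAlgebra.ad k L (g d) : L →ₗ[k] L)) hz fun ξ hξ a ha b hb c hc e he => by
      by_contra hne
      have := ((hasRankOn_of_pfaffian_ne_zero ha hb hc he hne).extend (V' := ⊤) (u := X)
        (w := g d) le_top Submodule.mem_top Submodule.mem_top (by rwa [hg.lie_X]) fun y hy => by
          rw [LinearMap.mem_ker, LieAlgebra.ad_apply] at hy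
          rw [← lie_skew, hy, neg_zero, map_zero]).index_add_le
      omega
  exact ⟨H, hH, by omega⟩

theorem IsFiliform.lcs_three_abelian [CharZero k] (h : IsFiliform k L)
    (hn : finrank k L = 10 ∨ finrank k L = 11) (hi : finrank k L < index k L + 8) :
    ∀ x ∈ lcs k L 3, ∀ y ∈ lcs k L 3, ⁅x, y⁆ = 0 := by
  obtain ⟨X, g, hg⟩ := h.exists_isFrame (by omega)
  have key : (∀ x ∈ tail k g 3, ∀ y ∈ tail k g 3, ⁅x, y⁆ = 0) ∨
      ∃ (ξ : Dual k L) (V : Submodule k L), HasRankOn ξ V 8 := by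
    obtain hn | hn := hn <;> rw [hn] at hg
    · exact hg.abelian_or_hasRankOn_of_nine
    · exact hg.abelian_or_hasRankOn_of_ten
  rw [hg.lcs_eq 3 (by omega)]
  obtain hab | ⟨ξ, V, hr⟩ := key
  · exact hab
  · have := hr.index_add_le
    omega

/-- The terms of the lower half of the central series are abelian. -/
theorem IsFiliform.lcs_abelian (h : IsFiliform k L) {j : ℕ} (hj : finrank k L ≤ 2 * j + 3)
    (hj' : 1 ≤ j) (hjn : j + 1 < finrank k L) : ∀ x ∈ lcs k L j, ∀ y ∈ lcs k L j, ⁅x, y⁆ = 0 := by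
  have hd := h.finrank_lcs hj' (by omega)
  have hd' := h.finrank_lcs (i := j + 1) (by omega) (by omega)
  have hz : ∀ {x y : L}, x ∈ lcs k L j → y ∈ lcs k L (j + 1) → ⁅x, y⁆ = 0 := by
    intro x y hx hy
    have h1 := lie_mem_lcs_add hx hy
    rwa [h.lcs_eq_bot (by omega) (by omega), Submodule.mem_bot] at h1
  have hlt : ¬ lcs k L j ≤ lcs k L (j + 1) := fun hle => by
    have := Submodule.finrank_mono hle
    omega
  obtain ⟨u, hu, hu'⟩ := SetLike.not_le_iff_exists.1 hlt
  have hdec : ∀ y ∈ lcs k L j, ∃ c : k, y - c • u ∈ lcs k L (j + 1) := fun y hy =>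
    exists_sub_smul_mem (lcs_antitone (Nat.le_succ j)) (by rw [Nat.succ_eq_add_one]; omega)
      hu hu' hy
  have huz : ∀ y ∈ lcs k L j, ⁅u, y⁆ = 0 := by
    intro y hy
    obtain ⟨c, hc⟩ := hdec y hy
    have := hz hu hc
    rwa [lie_sub, lie_smul, lie_self, smul_zero, sub_zero] at this
  intro x hx y hy
  obtain ⟨c, hc⟩ := hdec y hy
  have h1 := hz hx hc
  rwa [lie_sub, lie_smul, ← lie_skew x u, huz x hx, neg_zero, smul_zero, sub_zero] at h1

end Abelian

end FiliformR

/-- Every filiform Lie algebra of dimension `n ≤ 11`, over an algebraically closed field of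
characteristic zero, satisfies the R-property; that is, `α(L) ≥ c(L) - 1`. -/
theorem theorem8p7 (k : Type*) [Field k] [IsAlgClosed k] [CharZero k]
    (L : Type*) [LieRing L] [LieAlgebra k L] [FiniteDimensional k L]
    (n : ℕ) (hdim : Module.finrank k L = n) (hfil : FiliformR.IsFiliform k L) (hn : n ≤ 11) :
    FiliformR.HasRProperty k L ∧
      (FiliformR.maxAbelianDim k L : ℚ) ≥ FiliformR.magicNumber k L - 1 := by
  open FiliformR in
  suffices ∃ H : Submodule k L, (∀ x ∈ H, ∀ y ∈ H, ⁅x, y⁆ = 0) ∧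
      n + index k L ≤ 2 * Module.finrank k H + 2 by
    obtain ⟨H, hH, hle⟩ := this
    exact hasRProperty_of_abelian hdim H hH hle
  subst hdim
  by_cases h4 : Module.finrank k L < index k L + 4
  · exact exists_abelian_of_finrank_lt_index_add_four h4
  by_cases h6 : Module.finrank k L < index k L + 6
  · obtain ⟨H, hH, hle⟩ := hfil.exists_abelian_of_finrank_lt_index_add_six (by omega) h6
    exact ⟨H, hH, by omega⟩
  by_cases h8 : (Module.finrank k L = 10 ∨ Module.finrank k L = 11) ∧
      Module.finrank k L < index k L + 8
  · refine ⟨lcs k L 3, hfil.lcs_three_abelian h8.1 h8.2, ?_⟩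
    rw [hfil.finrank_lcs (by omega) (by omega)]
    omega
  -- What remains has index at most 3, hence at most 2 when `n` is even by parity; the chosen term
  -- has dimension `⌈n/2⌉`, which is just enough.
  · have hpar := even_finrank_add_index (k := k) (L := L)
    refine ⟨lcs k L (Module.finrank k L / 2 - 1),
      hfil.lcs_abelian (by omega) (by omega) (by omega), ?_⟩
    rw [hfil.finrank_lcs (by omega) (by omega)]
    rw [Nat.even_iff] at hpar
    omega
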